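/- Let $u$ be a probability density on $(0,1)$, i.e. $u\in L^1(0,1)$, $u\ge 0$ almost everywhere and $\int_0^1u(x)\,dx=1$. Let $\mu_u$ be the measure $u(x)\,dx$ on $(0,1)$, let $\lambda$ be Lebesgue measure on $(0,1)$, and let $U(x)=\int_0^xu(t)\,dt$. Let $$W_2(\mu_u,\lambda)=\Big(\inf_\gamma\int|x-y|^2\,d\gamma(x,y)\Big)^{1/2},$$ the infimum being over all Borel probability measures $\gamma$ on $(0,1)\times(0,1)$ with marginals $\mu_u$ and $\lambda$, and let $$\|\mu_u-\lambda\|_{\dot H^{-1}(\lambda)}=\sup\Big\{\Big|\int_0^1\varphi(x)\,(u(x)-1)\,dx\Big| : \varphi\in H^1(0,1),\ \int_0^1\varphi(x)\,dx=0,\ \|\varphi'\|_{L^2(0,1)}\le 1\Big\}.$$ Then $$\|\mu_u-\lambda\|_{\dot H^{-1}(\lambda)}=W_2(\mu_u,\lambda),$$ and the squares of both quantities are equal to $\int_0^1(U(x)-x)^2\,dx$. -/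

import Mathlib

open MeasureTheory Set
open scoped ENNReal ContDiff

namespace UnitInterval01

/-- Lebesgue measure on `(0,1)`, as a Borel measure on `ℝ` concentrated on `(0,1)`. -/
noncomputable def leb : Measure ℝ := volume.restrict (Ioo 0 1)

/-- `u` is a probability density on `(0,1)`; its values outside `(0,1)` are irrelevant. -/
structure IsProbDensity (u : ℝ → ℝ) : Prop where
  integrable : Integrable u leb
  nonneg : ∀ᵐ x ∂leb, 0 ≤ u x
  integral_eq_one : ∫ x, u x ∂leb = 1

/-- The measure `u(x) dx` on `(0,1)`. -/
noncomputable def densityMeasure (u : ℝ → ℝ) : Measure ℝ :=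
  leb.withDensity fun x => ENNReal.ofReal (u x)

/-- The cumulative distribution function `U(x) = ∫₀ˣ u(t) dt`. -/
noncomputable def densityCDF (u : ℝ → ℝ) (x : ℝ) : ℝ := ∫ t in (0 : ℝ)..x, u t

/-- `γ` is a coupling of `μ` and `ν`. If `μ` and `ν` are concentrated on a Borel set `Ω`,
then every coupling is concentrated on `Ω × Ω`. -/
structure IsCoupling (γ : Measure (ℝ × ℝ)) (μ ν : Measure ℝ) : Prop where
  isProbabilityMeasure : IsProbabilityMeasure γ
  left : ∀ A : Set ℝ, MeasurableSet A → γ (A ×ˢ univ) = μ A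
  right : ∀ A : Set ℝ, MeasurableSet A → γ (univ ×ˢ A) = ν A

/-- The quadratic Wasserstein distance `(inf_γ ∫ |x - y|² dγ(x,y))^(1/2)`. -/
noncomputable def wasserstein2 (μ ν : Measure ℝ) : ℝ≥0∞ :=
  (⨅ (γ : Measure (ℝ × ℝ)) (_ : IsCoupling γ μ ν),
    ∫⁻ p, ENNReal.ofReal (|p.1 - p.2| ^ 2) ∂γ) ^ (1 / 2 : ℝ)

/-- `φ' = g` on `(0,1)` in the weak sense: `∫ φ ψ' = - ∫ g ψ` for all `ψ ∈ C_c^∞((0,1))`. -/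
def HasWeakDeriv (φ g : ℝ → ℝ) : Prop :=
  ∀ ψ : ℝ → ℝ, ContDiff ℝ ∞ ψ → HasCompactSupport ψ → tsupport ψ ⊆ Ioo 0 1 →
    ∫ x, φ x * deriv ψ x ∂leb = -∫ x, g x * ψ x ∂leb

/-- `φ` is a zero-mean function in the Sobolev space `H¹(0,1)`, with weak derivative `g`. -/
structure IsHDotOne (φ g : ℝ → ℝ) : Prop where
  memLp : MemLp φ 2 leb
  memLp_deriv : MemLp g 2 leb
  hasWeakDeriv : HasWeakDeriv φ g
  zero_mean : ∫ x, φ x ∂leb = 0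

/-- The dual norm of the signed measure `t(x) dx` on `(0,1)` with integrable zero-mean density `t`:
the supremum of `|∫ φ t|` over zero-mean `φ ∈ H¹(0,1)` with `‖φ'‖_{L²} ≤ 1`.
Functions in `H¹(0,1)` are essentially bounded, so that `φ t` is integrable. -/
noncomputable def hDotNegOneNorm (t : ℝ → ℝ) : ℝ≥0∞ :=
  ⨆ (φ : ℝ → ℝ) (g : ℝ → ℝ) (_ : IsHDotOne φ g) (_ : eLpNorm g 2 leb ≤ 1),
    ENNReal.ofReal |∫ x, φ x * t x ∂leb|

end UnitInterval01

/-!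
Write `U` for the distribution function of `u`. Both distances equal the `L²(0,1)` norm of
`T(x) = U(x) - x`, the primitive of `u - 1` that vanishes at `0` and at `1`.

For the dual Sobolev norm, the du Bois-Reymond lemma shows that a function `φ` with weak derivative
`g` is almost everywhere a constant plus the primitive of `g`. Integration by parts for absolutely
continuous functions then gives `∫ φ (u - 1) = -∫ g T`. The Cauchy-Schwarz inequality bounds this by
`‖T‖` and, if `T ≠ 0`, the choice `g = T / ‖T‖` attains the bound (`hDotNegOneNorm_eq`).

For the Wasserstein distance, `U` is monotone and, being continuous, pushes `u dx` forward to
Lebesgue measure (`IsProbDensity.map_densityCDF`). Monotone maps are optimal: Young's inequality for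
a primitive of the map and its Legendre transform bounds the cost of every coupling from below by
the cost of the map (`wasserstein2_map_of_monotone`). Hence `W₂² = ∫ (x - U)² u`. Since
`T² (u - 1)` is the derivative of `T³ / 3`, which vanishes at both ends, the weight `u` may be
replaced by `1` (`IsProbDensity.integral_cost`).
-/

namespace UnitInterval01

/-! ### Integration by parts for primitives -/

lemma integral_leb (f : ℝ → ℝ) : ∫ x, f x ∂leb = ∫ x in (0 : ℝ)..1, f x := by
  rw [intervalIntegral.integral_of_le zero_le_one, integral_Ioc_eq_integral_Ioo, leb]

lemma integrable_leb_iff {f : ℝ → ℝ} :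
    Integrable f leb ↔ IntervalIntegrable f volume 0 1 := by
  rw [intervalIntegrable_iff_integrableOn_Ioo_of_le zero_le_one, leb, IntegrableOn]

instance : IsProbabilityMeasure leb := ⟨by simp [leb]⟩

lemma ae_leb_mem : ∀ᵐ x ∂leb, x ∈ Ioo (0 : ℝ) 1 := ae_restrict_mem measurableSet_Ioo

lemma ae_hasDerivAt_primitive {f : ℝ → ℝ} (hf : IntervalIntegrable f volume 0 1) :
    ∀ᵐ x, x ∈ uIcc (0 : ℝ) 1 → HasDerivAt (fun x => ∫ t in (0 : ℝ)..x, f t) (f x) x := by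
  filter_upwards [hf.ae_hasDerivAt_integral] with x hx h using hx h 0 (by simp)

/-- Integration by parts for two absolutely continuous functions that are given as primitives. -/
lemma integral_primitive_mul {f g : ℝ → ℝ} (hf : IntervalIntegrable f volume 0 1)
    (hg : IntervalIntegrable g volume 0 1) :
    ∫ x in (0 : ℝ)..1, (∫ t in (0 : ℝ)..x, f t) * g x =
      (∫ t in (0 : ℝ)..1, f t) * (∫ t in (0 : ℝ)..1, g t) -
        ∫ x in (0 : ℝ)..1, f x * ∫ t in (0 : ℝ)..x, g t := by
  have hF := hf.absolutelyContinuousOnInterval_intervalIntegral (c := 0) (by simp)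
  have hG := hg.absolutelyContinuousOnInterval_intervalIntegral (c := 0) (by simp)
  have key := hF.integral_mul_deriv_eq_deriv_mul hG
  simp only [intervalIntegral.integral_same, zero_mul, sub_zero] at key
  rw [intervalIntegral.integral_congr_ae (g := fun x => (∫ t in (0 : ℝ)..x, f t) *
      deriv (fun x => ∫ t in (0 : ℝ)..x, g t) x), key]
  · congr 1
    apply intervalIntegral.integral_congr_ae
    filter_upwards [ae_hasDerivAt_primitive hf] with x hx h
    rw [(hx (uIoc_subset_uIcc h)).deriv]
  · filter_upwards [ae_hasDerivAt_primitive hg] with x hx h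
    rw [(hx (uIoc_subset_uIcc h)).deriv]

/-- The integrand is the derivative of `F³ / 3`, where `F` is the primitive of `f`. -/
lemma integral_primitive_sq_mul_eq_zero {f : ℝ → ℝ} (hf : IntervalIntegrable f volume 0 1)
    (h0 : ∫ t in (0 : ℝ)..1, f t = 0) :
    ∫ x in (0 : ℝ)..1, (∫ t in (0 : ℝ)..x, f t) ^ 2 * f x = 0 := by
  have hF := hf.absolutelyContinuousOnInterval_intervalIntegral (c := 0) (by simp)
  have key := (hF.fun_mul (hF.fun_mul hF)).integral_deriv_eq_sub
  simp only [intervalIntegral.integral_same, h0, mul_zero, sub_zero] at key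
  have : ∫ x in (0 : ℝ)..1, 3 * ((∫ t in (0 : ℝ)..x, f t) ^ 2 * f x) = 0 := by
    refine Eq.trans (intervalIntegral.integral_congr_ae ?_) key
    filter_upwards [ae_hasDerivAt_primitive hf] with x hx h
    have hd := hx (uIoc_subset_uIcc h)
    have hd3 := (hd.fun_mul (hd.fun_mul hd)).deriv
    rw [hd3]
    ring
  rw [intervalIntegral.integral_const_mul] at this
  linarith

/-! ### Weak derivatives on the unit interval -/

lemma integral_deriv_test {ψ : ℝ → ℝ} (hψ : ContDiff ℝ ∞ ψ) (hs : tsupport ψ ⊆ Ioo 0 1) (x : ℝ) :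
    ∫ t in (0 : ℝ)..x, deriv ψ t = ψ x := by
  have h0 : ψ 0 = 0 := image_eq_zero_of_notMem_tsupport fun h => by simpa using hs h
  rw [intervalIntegral.integral_deriv_eq_sub, h0, sub_zero]
  · exact fun t _ => (hψ.differentiable (by simp)).differentiableAt
  · exact (hψ.continuous_deriv (by simp)).intervalIntegrable _ _

lemma hasWeakDeriv_primitive {g : ℝ → ℝ} (hg : IntervalIntegrable g volume 0 1) (c : ℝ) :
    HasWeakDeriv (fun x => c + ∫ t in (0 : ℝ)..x, g t) g := by
  intro ψ hψ _ hs
  have h1 : ψ 1 = 0 := image_eq_zero_of_notMem_tsupport fun h => by simpa using hs h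
  have hψ' : IntervalIntegrable (deriv ψ) volume 0 1 :=
    (hψ.continuous_deriv (by simp)).intervalIntegrable _ _
  have hG := (hg.absolutelyContinuousOnInterval_intervalIntegral (c := 0) (by simp)).continuousOn
  rw [integral_leb, integral_leb]
  simp only [add_mul]
  rw [intervalIntegral.integral_add (hψ'.const_mul c) (hψ'.continuousOn_mul hG),
    intervalIntegral.integral_const_mul, integral_primitive_mul hg hψ']
  simp only [integral_deriv_test hψ hs, h1]
  ring

/-- The **du Bois-Reymond lemma**: an integrable function whose weak derivative vanishes is almost
everywhere constant. -/
lemma ae_eq_const_of_hasWeakDeriv_zero {h : ℝ → ℝ} (hh : Integrable h leb)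
    (hw : HasWeakDeriv h fun _ => 0) : ∃ c, h =ᵐ[leb] fun _ => c := by
  let b : ContDiffBump (1 / 2 : ℝ) := ⟨1 / 8, 1 / 4, by norm_num, by norm_num⟩
  let η₀ : ℝ → ℝ := b.normed volume
  have hη₀ : ContDiff ℝ ∞ η₀ := b.contDiff_normed
  have hη₀c : HasCompactSupport η₀ := b.hasCompactSupport_normed
  have hη₀s : tsupport η₀ = Metric.closedBall (1 / 2) (1 / 4) := b.tsupport_normed_eq
  have hη₀I : ∫ x, η₀ x = 1 := b.integral_normed
  have hη₀s' : tsupport η₀ ⊆ Ioo 0 1 := by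
    rw [hη₀s, Real.closedBall_eq_Icc]
    exact Icc_subset_Ioo (by norm_num) (by norm_num)
  have hbdd : ∀ η : ℝ → ℝ, ContDiff ℝ ∞ η → HasCompactSupport η →
      Integrable (fun x => h x * η x) leb := by
    intro η h1 h2
    obtain ⟨C, hC⟩ := h1.continuous.bounded_above_of_compact_support h2
    exact hh.mul_bdd (c := C) h1.continuous.aestronglyMeasurable (ae_of_all _ hC)
  have hsub : ∀ η : ℝ → ℝ, tsupport η ⊆ Ioo 0 1 → ∀ f : ℝ → ℝ,
      ∫ x, η x * f x = ∫ x, η x * f x ∂leb := by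
    intro η hs f
    rw [leb, setIntegral_eq_integral_of_forall_compl_eq_zero]
    intro x hx
    rw [image_eq_zero_of_notMem_tsupport fun h' => hx (hs h'), zero_mul]
  refine ⟨∫ x, h x * η₀ x ∂leb, ?_⟩
  set c := ∫ x, h x * η₀ x ∂leb
  suffices H : ∀ᵐ x, x ∈ Ioo (0 : ℝ) 1 → h x - c = 0 by
    rw [Filter.EventuallyEq, leb, ae_restrict_iff' measurableSet_Ioo]
    filter_upwards [H] with x hx hm using sub_eq_zero.1 (hx hm)
  have hhc : Integrable (fun x => h x - c) leb := hh.sub (integrable_const c)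
  refine isOpen_Ioo.ae_eq_zero_of_integral_contDiff_smul_eq_zero
    (IntegrableOn.locallyIntegrableOn hhc) ?_
  intro η hη hηc hηs
  -- `ζ = η - (∫ η) η₀` has integral zero, so its primitive is a test function.
  let m := ∫ x, η x
  let ζ : ℝ → ℝ := fun x => η x - m * η₀ x
  have hζ : ContDiff ℝ ∞ ζ := hη.sub (contDiff_const.mul hη₀)
  let ψ : ℝ → ℝ := fun x => ∫ t in (0 : ℝ)..x, ζ t
  have hψd : ∀ x, HasDerivAt ψ (ζ x) x := fun x =>
    intervalIntegral.integral_hasDerivAt_right (hζ.continuous.intervalIntegrable _ _)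
      (hζ.continuous.stronglyMeasurableAtFilter _ _) hζ.continuous.continuousAt
  have hψ' : deriv ψ = ζ := funext fun x => (hψd x).deriv
  have hψ : ContDiff ℝ ∞ ψ := contDiff_infty_iff_deriv.2
    ⟨fun x => (hψd x).differentiableAt, hψ' ▸ hζ⟩
  have hηi : Integrable η := hη.continuous.integrable_of_hasCompactSupport hηc
  have hη₀i : Integrable η₀ := hη₀.continuous.integrable_of_hasCompactSupport hη₀c
  let K := tsupport η ∪ tsupport η₀
  have hK : IsCompact K := hηc.isCompact.union hη₀c.isCompact
  have hKne : K.Nonempty := ⟨1 / 2, Or.inr (by rw [hη₀s]; simp)⟩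
  have hK01 : K ⊆ Ioo 0 1 := union_subset hηs hη₀s'
  have hζK : ∀ x, x ∉ K → ζ x = 0 := by
    intro x hx
    simp only [K, mem_union, not_or] at hx
    simp [ζ, image_eq_zero_of_notMem_tsupport hx.1, image_eq_zero_of_notMem_tsupport hx.2]
  have ha := hK01 (hK.sInf_mem hKne)
  have hb := hK01 (hK.sSup_mem hKne)
  have hζa : ∀ x, x < sInf K → ζ x = 0 := fun x hx =>
    hζK x fun hxK => absurd (csInf_le hK.bddBelow hxK) (not_le.2 hx)
  have hζb : ∀ x, sSup K < x → ζ x = 0 := fun x hx =>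
    hζK x fun hxK => absurd (le_csSup hK.bddAbove hxK) (not_le.2 hx)
  have hζ01 : ψ 1 = 0 := by
    simp only [ψ]
    rw [← integral_leb, leb, setIntegral_eq_integral_of_forall_compl_eq_zero
      fun x hx => hζK x fun h' => hx (hK01 h')]
    simp only [ζ]
    rw [integral_sub hηi (hη₀i.const_mul m), integral_const_mul, hη₀I]
    simp [m]
  have hψK : ∀ x, x ∉ Icc (sInf K) (sSup K) → ψ x = 0 := by
    intro x hx
    rcases lt_or_ge x (sInf K) with hxa | hxa
    · refine intervalIntegral.integral_zero_ae (ae_of_all _ fun t ht => hζa t ?_)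
      exact ht.2.trans_lt (max_lt ha.1 hxa)
    · have hxb : sSup K < x := not_le.1 fun h' => hx ⟨hxa, h'⟩
      have : ψ x = ψ 1 + ∫ t in (1 : ℝ)..x, ζ t :=
        (intervalIntegral.integral_add_adjacent_intervals
          (hζ.continuous.intervalIntegrable _ _) (hζ.continuous.intervalIntegrable _ _)).symm
      rw [this, hζ01, zero_add]
      refine intervalIntegral.integral_zero_ae (ae_of_all _ fun t ht => hζb t ?_)
      exact (lt_min hb.2 hxb).trans ht.1
  have hψc : HasCompactSupport ψ := HasCompactSupport.intro isCompact_Icc (fun x hx => hψK x hx)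
  have hψs : tsupport ψ ⊆ Ioo 0 1 := by
    refine (closure_minimal (fun x hx => ?_) isClosed_Icc).trans (Icc_subset_Ioo ha.1 hb.2)
    by_contra hx'
    exact hx (hψK x hx')
  have key := hw ψ hψ hψc hψs
  simp only [hψ', ζ, zero_mul, integral_zero, neg_zero, mul_sub] at key
  have e : ∀ x, h x * (m * η₀ x) = m * (h x * η₀ x) := fun x => by ring
  simp only [e] at key
  rw [integral_sub (hbdd η hη hηc) ((hbdd η₀ hη₀ hη₀c).const_mul m), integral_const_mul] at key
  have hm : m = ∫ x, η x ∂leb := by simpa using hsub η hηs fun _ => 1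
  simp only [smul_eq_mul]
  rw [hsub η hηs]
  simp only [mul_sub]
  rw [integral_sub, integral_mul_const, ← hm]
  · simp only [mul_comm (η _)]
    exact key
  · simpa only [mul_comm (η _)] using hbdd η hη hηc
  · exact (hηi.restrict).mul_const c

/-- A function with an integrable weak derivative `g` is, up to a null set, a primitive of `g`. -/
lemma HasWeakDeriv.ae_eq_primitive {φ g : ℝ → ℝ} (hφ : Integrable φ leb) (hg : Integrable g leb)
    (hw : HasWeakDeriv φ g) :
    ∃ c, φ =ᵐ[leb] fun x => c + ∫ t in (0 : ℝ)..x, g t := by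
  have hgi := integrable_leb_iff.1 hg
  have hG := (hgi.absolutelyContinuousOnInterval_intervalIntegral (c := 0) (by simp)).continuousOn
  have hGi : Integrable (fun x => ∫ t in (0 : ℝ)..x, g t) leb :=
    integrable_leb_iff.2 hG.intervalIntegrable
  obtain ⟨c, hc⟩ := ae_eq_const_of_hasWeakDeriv_zero (hφ.sub hGi) (by
    intro ψ h1 h2 h3
    have hd : ContDiff ℝ ∞ (deriv ψ) := (contDiff_infty_iff_deriv.1 h1).2
    obtain ⟨C, hC⟩ := hd.continuous.bounded_above_of_compact_support h2.deriv
    have hb : ∀ f : ℝ → ℝ, Integrable f leb → Integrable (fun x => f x * deriv ψ x) leb :=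
      fun f hf => hf.mul_bdd (c := C) hd.continuous.aestronglyMeasurable (ae_of_all _ hC)
    have e := hasWeakDeriv_primitive hgi 0 ψ h1 h2 h3
    simp only [zero_add] at e
    simp only [Pi.sub_apply, sub_mul, zero_mul, integral_zero, neg_zero]
    rw [integral_sub (hb _ hφ) (hb _ hGi), hw ψ h1 h2 h3, e, sub_self])
  refine ⟨c, ?_⟩
  filter_upwards [hc] with x hx
  simp only [Pi.sub_apply] at hx
  linarith

/-! ### The dual Sobolev norm -/

lemma eLpNorm_two_leb {f : ℝ → ℝ} (hf : MemLp f 2 leb) :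
    eLpNorm f 2 leb = ENNReal.ofReal (√(∫ x in (0 : ℝ)..1, f x ^ 2)) := by
  rw [hf.eLpNorm_eq_integral_rpow_norm (by simp) (by simp), Real.sqrt_eq_rpow, ← integral_leb]
  simp

/-- The pairing of a function `φ` with weak derivative `g` and an integrable zero-mean density is
computed by integrating by parts. -/
lemma IsHDotOne.integral_mul {φ g t : ℝ → ℝ} (h : IsHDotOne φ g) (ht : Integrable t leb)
    (ht0 : ∫ x, t x ∂leb = 0) :
    ∫ x, φ x * t x ∂leb = -∫ x, g x * (∫ s in (0 : ℝ)..x, t s) ∂leb := by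
  have hg : Integrable g leb := h.memLp_deriv.integrable one_le_two
  obtain ⟨c, hc⟩ := h.hasWeakDeriv.ae_eq_primitive (h.memLp.integrable one_le_two) hg
  have hgi := integrable_leb_iff.1 hg
  have hti := integrable_leb_iff.1 ht
  have hG := (hgi.absolutelyContinuousOnInterval_intervalIntegral (c := 0) (by simp)).continuousOn
  rw [integral_leb] at ht0
  have : ∫ x, φ x * t x ∂leb = ∫ x, (c + ∫ s in (0 : ℝ)..x, g s) * t x ∂leb := by
    apply integral_congr_ae
    filter_upwards [hc] with x hx
    rw [hx]
  rw [this, integral_leb, integral_leb]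
  simp only [add_mul]
  rw [intervalIntegral.integral_add (hti.const_mul c) (hti.continuousOn_mul hG),
    intervalIntegral.integral_const_mul, integral_primitive_mul hgi hti, ht0]
  ring

lemma memLp_primitive {t : ℝ → ℝ} (ht : Integrable t leb) :
    MemLp (fun x => ∫ s in (0 : ℝ)..x, t s) 2 leb := by
  have hti := integrable_leb_iff.1 ht
  have hT := (hti.absolutelyContinuousOnInterval_intervalIntegral (c := 0) (by simp)).continuousOn
  rw [uIcc_of_le zero_le_one] at hT
  obtain ⟨C, hC⟩ := isCompact_Icc.exists_bound_of_continuousOn hT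
  refine MemLp.of_bound ((hT.mono Ioo_subset_Icc_self).aestronglyMeasurable measurableSet_Ioo) C ?_
  filter_upwards [ae_leb_mem] with x hx using hC x (Ioo_subset_Icc_self hx)

/-- The dual norm of an integrable zero-mean density is the `L²` norm of its primitive `T`. The
supremum is attained at the zero-mean primitive of `T / ‖T‖` (or at any function if `T = 0`). -/
theorem hDotNegOneNorm_eq {t : ℝ → ℝ} (ht : Integrable t leb) (ht0 : ∫ x, t x ∂leb = 0) :
    hDotNegOneNorm t =
      ENNReal.ofReal (√(∫ x in (0 : ℝ)..1, (∫ s in (0 : ℝ)..x, t s) ^ 2)) := by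
  set T : ℝ → ℝ := fun x => ∫ s in (0 : ℝ)..x, t s with hTdef
  have hT : MemLp T 2 leb := memLp_primitive ht
  apply le_antisymm
  · refine iSup_le fun φ => iSup_le fun g => iSup_le fun h => iSup_le fun hg => ?_
    rw [h.integral_mul ht ht0, abs_neg, ← eLpNorm_two_leb hT, ← Real.enorm_eq_ofReal_abs]
    calc ‖∫ x, g x * T x ∂leb‖ₑ ≤ ∫⁻ x, ‖g x * T x‖ₑ ∂leb := enorm_integral_le_lintegral_enorm _
      _ = eLpNorm (g • T) 1 leb := by rw [eLpNorm_one_eq_lintegral_enorm]; rfl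
      _ ≤ eLpNorm g 2 leb * eLpNorm T 2 leb :=
        eLpNorm_smul_le_mul_eLpNorm hT.aestronglyMeasurable h.memLp_deriv.aestronglyMeasurable
      _ ≤ eLpNorm T 2 leb := by simpa using mul_le_mul_left hg (eLpNorm T 2 leb)
  · set S := ∫ x in (0 : ℝ)..1, T x ^ 2 with hS
    have hS0 : 0 ≤ S := intervalIntegral.integral_nonneg zero_le_one fun x _ => sq_nonneg _
    rcases hS0.eq_or_lt with h0 | hpos
    · simp [← h0]
    have hr : 0 < √S := Real.sqrt_pos.2 hpos
    let g : ℝ → ℝ := fun x => (√S)⁻¹ * T x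
    have hg : MemLp g 2 leb := hT.const_mul _
    have hgi : Integrable g leb := hg.integrable one_le_two
    have hG := memLp_primitive hgi
    let c := ∫ x, (∫ s in (0 : ℝ)..x, g s) ∂leb
    have hφ : IsHDotOne (fun x => -c + ∫ s in (0 : ℝ)..x, g s) g :=
      { memLp := (memLp_const (-c)).add hG
        memLp_deriv := hg
        hasWeakDeriv := hasWeakDeriv_primitive (integrable_leb_iff.1 hgi) _
        zero_mean := by
          rw [integral_add (integrable_const _) (hG.integrable one_le_two)]
          simp [c] }
    have hg1 : eLpNorm g 2 leb ≤ 1 := by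
      rw [eLpNorm_two_leb hg]
      simp only [g, mul_pow]
      rw [intervalIntegral.integral_const_mul, ← hS, inv_pow, Real.sq_sqrt hS0,
        inv_mul_cancel₀ hpos.ne']
      simp
    have hval : |∫ x, (-c + ∫ s in (0 : ℝ)..x, g s) * t x ∂leb| = √S := by
      rw [hφ.integral_mul ht ht0, abs_neg, integral_leb]
      have : ∀ x, g x * (∫ s in (0 : ℝ)..x, t s) = (√S)⁻¹ * T x ^ 2 := fun x => by
        simp only [g, hTdef]; ring
      simp only [this]
      rw [intervalIntegral.integral_const_mul, ← hS, abs_of_nonneg (by positivity)]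
      rw [inv_mul_eq_iff_eq_mul₀ hr.ne', Real.mul_self_sqrt hS0]
    rw [← hval]
    exact le_iSup_of_le _ (le_iSup_of_le g (le_iSup_of_le hφ (le_iSup_of_le hg1 le_rfl)))

/-! ### Monotone maps are optimal -/

/-- The Legendre transform of `Φ`, with the supremum taken over the unit interval. It is a genuine
supremum only if `Φ` is bounded below there. -/
noncomputable def legendre (Φ : ℝ → ℝ) (y : ℝ) : ℝ := ⨆ z : Icc (0 : ℝ) 1, (y * z - Φ z)

section Legendre

variable {Φ : ℝ → ℝ}

lemma bddAbove_legendre (hΦ : ∀ z ∈ Icc (0 : ℝ) 1, 0 ≤ Φ z) (y : ℝ) :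
    BddAbove (range fun z : Icc (0 : ℝ) 1 => y * z - Φ z) := by
  refine ⟨|y|, ?_⟩
  rintro _ ⟨z, rfl⟩
  have h1 : y * z ≤ |y| * z := mul_le_mul_of_nonneg_right (le_abs_self y) z.2.1
  have h2 : |y| * z ≤ |y| := mul_le_of_le_one_right (abs_nonneg y) z.2.2
  have h3 := hΦ z z.2
  dsimp only
  linarith

lemma mul_le_add_legendre (hΦ : ∀ z ∈ Icc (0 : ℝ) 1, 0 ≤ Φ z) {x : ℝ} (hx : x ∈ Icc (0 : ℝ) 1)
    (y : ℝ) : x * y ≤ Φ x + legendre Φ y := by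
  have : y * x - Φ x ≤ legendre Φ y := le_ciSup (bddAbove_legendre hΦ y) (⟨x, hx⟩ : Icc (0 : ℝ) 1)
  linarith

/-- Young's inequality is an equality at `(x, y)` if `y` is a subgradient of `Φ` at `x`. -/
lemma mul_eq_add_legendre (hΦ : ∀ z ∈ Icc (0 : ℝ) 1, 0 ≤ Φ z) {x y : ℝ} (hx : x ∈ Icc (0 : ℝ) 1)
    (h : ∀ z ∈ Icc (0 : ℝ) 1, y * (z - x) ≤ Φ z - Φ x) : x * y = Φ x + legendre Φ y := by
  refine le_antisymm (mul_le_add_legendre hΦ hx y) ?_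
  have : legendre Φ y ≤ y * x - Φ x := by
    have : Nonempty (Icc (0 : ℝ) 1) := ⟨⟨x, hx⟩⟩
    exact ciSup_le fun z => by linarith [h z z.2]
  linarith

lemma monotone_legendre (hΦ : ∀ z ∈ Icc (0 : ℝ) 1, 0 ≤ Φ z) : Monotone (legendre Φ) := by
  intro a b hab
  refine ciSup_mono (bddAbove_legendre hΦ b) fun z => ?_
  have := mul_le_mul_of_nonneg_right hab z.2.1
  linarith

end Legendre

/-- A monotone map `T` of the unit interval is an optimal transport map for the quadratic cost. It
is a subgradient of its primitive `Φ`, so by Young's inequality every coupling satisfies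
`|x - y|² ≥ (x² - 2 Φ(x)) + (y² - 2 Φ*(y))` almost everywhere, with equality on the graph of `T`.
The integral of the right-hand side depends only on the marginals. -/
theorem wasserstein2_map_of_monotone {μ : Measure ℝ} [IsProbabilityMeasure μ]
    (hμ : ∀ᵐ x ∂μ, x ∈ Icc (0 : ℝ) 1) {T : ℝ → ℝ} (hT : Monotone T) (h0 : 0 ≤ T 0)
    (h1 : T 1 ≤ 1) :
    wasserstein2 μ (μ.map T) = ENNReal.ofReal (√(∫ x, (x - T x) ^ 2 ∂μ)) := by
  have hT01 : ∀ x ∈ Icc (0 : ℝ) 1, T x ∈ Icc (0 : ℝ) 1 := fun x hx =>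
    ⟨h0.trans (hT hx.1), (hT hx.2).trans h1⟩
  have hTm : Measurable T := hT.measurable
  have hTint : ∀ a b : ℝ, IntervalIntegrable T volume a b := fun a b =>
    (hT.monotoneOn _).intervalIntegrable
  have : IsProbabilityMeasure (μ.map T) := Measure.isProbabilityMeasure_map hTm.aemeasurable
  have hν : ∀ᵐ y ∂(μ.map T), y ∈ Icc (0 : ℝ) 1 := by
    refine (ae_map_iff (p := fun y => y ∈ Icc (0 : ℝ) 1) hTm.aemeasurable measurableSet_Icc).2 ?_
    filter_upwards [hμ] with x hx using hT01 x hx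
  suffices H : (⨅ (γ : Measure (ℝ × ℝ)) (_ : IsCoupling γ μ (μ.map T)),
      ∫⁻ p, ENNReal.ofReal (|p.1 - p.2| ^ 2) ∂γ) = ENNReal.ofReal (∫ x, (x - T x) ^ 2 ∂μ) by
    rw [wasserstein2, H, Real.sqrt_eq_rpow,
      ENNReal.ofReal_rpow_of_nonneg (integral_nonneg fun x => sq_nonneg _) (by norm_num)]
  have hcost : Integrable (fun x => (x - T x) ^ 2) μ := by
    refine Integrable.of_bound ((measurable_id.sub hTm).pow_const 2).aestronglyMeasurable 1 ?_
    filter_upwards [hμ] with x hx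
    have := hT01 x hx
    rw [Real.norm_of_nonneg (sq_nonneg _)]
    simp only [mem_Icc] at hx this
    nlinarith
  apply le_antisymm
  · have hg : Measurable fun x => (x, T x) := measurable_id.prodMk hTm
    have hγ : IsCoupling (μ.map fun x => (x, T x)) μ (μ.map T) :=
      { isProbabilityMeasure := Measure.isProbabilityMeasure_map hg.aemeasurable
        left := fun A hA => by
          rw [Measure.map_apply hg (hA.prod MeasurableSet.univ)]
          congr 1
          ext x
          simp
        right := fun A hA => by
          rw [Measure.map_apply hg (MeasurableSet.univ.prod hA), Measure.map_apply hTm hA]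
          congr 1
          ext x
          simp }
    refine iInf₂_le_of_le _ hγ ?_
    rw [lintegral_map (by fun_prop) hg,
      ofReal_integral_eq_lintegral_ofReal hcost (ae_of_all _ fun x => sq_nonneg _)]
    simp only [sq_abs, le_refl]
  · refine le_iInf₂ fun γ hγ => ?_
    have := hγ.isProbabilityMeasure
    have hfst : γ.map Prod.fst = μ := by
      ext A hA
      rw [Measure.map_apply measurable_fst hA, ← hγ.left A hA, prod_univ]
    have hsnd : γ.map Prod.snd = μ.map T := by
      ext A hA
      rw [Measure.map_apply measurable_snd hA, ← hγ.right A hA, univ_prod]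
    have hγ1 : ∀ᵐ p ∂γ, p.1 ∈ Icc (0 : ℝ) 1 :=
      ae_of_ae_map measurable_fst.aemeasurable (by rwa [hfst])
    have hγ2 : ∀ᵐ p ∂γ, p.2 ∈ Icc (0 : ℝ) 1 :=
      ae_of_ae_map measurable_snd.aemeasurable (by rwa [hsnd])
    let Φ : ℝ → ℝ := fun x => ∫ t in (0 : ℝ)..x, T t
    have hΦc : Continuous Φ := intervalIntegral.continuous_primitive hTint 0
    have hΦ0 : ∀ z ∈ Icc (0 : ℝ) 1, 0 ≤ Φ z := fun z hz =>
      intervalIntegral.integral_nonneg hz.1 fun t ht => h0.trans (hT ht.1)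
    have hΦ1 : ∀ z ∈ Icc (0 : ℝ) 1, Φ z ≤ 1 := fun z hz => by
      have : Φ z ≤ ∫ t in (0 : ℝ)..z, (1 : ℝ) :=
        intervalIntegral.integral_mono_on hz.1 (hTint _ _) intervalIntegrable_const
          fun t ht => (hT (ht.2.trans hz.2)).trans h1
      simp only [intervalIntegral.integral_const, sub_zero, smul_eq_mul, mul_one] at this
      exact this.trans hz.2
    have hsub : ∀ x z, T x * (z - x) ≤ Φ z - Φ x := by
      intro x z
      have e : Φ z - Φ x = ∫ t in x..z, T t :=
        intervalIntegral.integral_interval_sub_left (hTint _ _) (hTint _ _)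
      rw [e]
      rcases le_total x z with h | h
      · have : ∫ t in x..z, T x ≤ ∫ t in x..z, T t :=
          intervalIntegral.integral_mono_on h intervalIntegrable_const (hTint _ _)
            fun t ht => hT ht.1
        simpa [mul_comm] using this
      · have : ∫ t in z..x, T t ≤ ∫ t in z..x, T x :=
          intervalIntegral.integral_mono_on h (hTint _ _) intervalIntegrable_const
            fun t ht => hT ht.2
        rw [intervalIntegral.integral_symm]
        simp only [intervalIntegral.integral_const, smul_eq_mul] at this
        linarith
    have hL0 : ∀ y, 0 ≤ legendre Φ y := fun y => by
      have := mul_le_add_legendre hΦ0 (x := 0) (by simp) y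
      simpa [Φ] using this
    have hL1 : ∀ y ∈ Icc (0 : ℝ) 1, legendre Φ y ≤ 1 := fun y hy => by
      have : Nonempty (Icc (0 : ℝ) 1) := ⟨⟨0, by simp⟩⟩
      refine ciSup_le fun z => ?_
      have := hΦ0 z z.2
      have := mul_le_one₀ hy.2 z.2.1 z.2.2
      linarith
    let a : ℝ → ℝ := fun x => x ^ 2 - 2 * Φ x
    let b : ℝ → ℝ := fun y => y ^ 2 - 2 * legendre Φ y
    have ham : Measurable a := by
      have := hΦc.measurable
      fun_prop
    have hbm : Measurable b := by
      have := (monotone_legendre hΦ0).measurable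
      fun_prop
    have haμ : Integrable a μ := by
      refine Integrable.of_bound ham.aestronglyMeasurable 2 ?_
      filter_upwards [hμ] with x hx
      have := hΦ0 x hx
      have := hΦ1 x hx
      rw [Real.norm_eq_abs, abs_le]
      constructor <;> simp only [a] <;> nlinarith [hx.1, hx.2]
    have hbν : Integrable b (μ.map T) := by
      refine Integrable.of_bound hbm.aestronglyMeasurable 2 ?_
      filter_upwards [hν] with y hy
      have := hL0 y
      have := hL1 y hy
      rw [Real.norm_eq_abs, abs_le]
      constructor <;> simp only [b] <;> nlinarith [hy.1, hy.2]
    have haγ : Integrable (fun p : ℝ × ℝ => a p.1) γ := by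
      rw [← hfst] at haμ
      exact haμ.comp_measurable measurable_fst
    have hbγ : Integrable (fun p : ℝ × ℝ => b p.2) γ := by
      rw [← hsnd] at hbν
      exact hbν.comp_measurable measurable_snd
    have hbT : Integrable (fun x => b (T x)) μ := hbν.comp_measurable hTm
    have hcγ : Integrable (fun p : ℝ × ℝ => |p.1 - p.2| ^ 2) γ := by
      refine Integrable.of_bound (by fun_prop) 1 ?_
      filter_upwards [hγ1, hγ2] with p hp hq
      rw [Real.norm_of_nonneg (sq_nonneg _), sq_abs]
      simp only [mem_Icc] at hp hq
      nlinarith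
    rw [← ofReal_integral_eq_lintegral_ofReal hcγ (ae_of_all _ fun p => sq_nonneg _)]
    apply ENNReal.ofReal_le_ofReal
    calc ∫ x, (x - T x) ^ 2 ∂μ = ∫ x, a x + b (T x) ∂μ := by
          apply integral_congr_ae
          filter_upwards [hμ] with x hx
          have := mul_eq_add_legendre hΦ0 hx fun z _ => hsub x z
          simp only [a, b]
          linarith
      _ = ∫ p, a p.1 + b p.2 ∂γ := by
          rw [integral_add haμ hbT, integral_add haγ hbγ]
          congr 1
          · rw [← integral_map measurable_fst.aemeasurable (f := a) ham.aestronglyMeasurable, hfst]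
          · rw [← integral_map measurable_snd.aemeasurable (f := b) hbm.aestronglyMeasurable, hsnd,
              integral_map hTm.aemeasurable hbm.aestronglyMeasurable]
      _ ≤ ∫ p, |p.1 - p.2| ^ 2 ∂γ := by
          refine integral_mono_ae (haγ.add hbγ) hcγ ?_
          filter_upwards [hγ1] with p hp
          have := mul_le_add_legendre hΦ0 hp p.2
          simp only [a, b, sq_abs]
          linarith

/-! ### The distribution function as a transport map -/

section Density

variable {v : ℝ → ℝ}

lemma ae_densityMeasure_mem (v : ℝ → ℝ) : ∀ᵐ x ∂densityMeasure v, x ∈ Ioo (0 : ℝ) 1 :=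
  (withDensity_absolutelyContinuous _ _).ae_le ae_leb_mem

lemma IsProbDensity.isProbabilityMeasure (hv : IsProbDensity v) :
    IsProbabilityMeasure (densityMeasure v) := by
  constructor
  rw [densityMeasure, withDensity_apply _ MeasurableSet.univ, Measure.restrict_univ,
    ← ofReal_integral_eq_lintegral_ofReal hv.integrable hv.nonneg, hv.integral_eq_one,
    ENNReal.ofReal_one]

lemma IsProbDensity.densityMeasure_Iic (hv : IsProbDensity v) {a : ℝ} (ha : a ∈ Icc (0 : ℝ) 1) :
    densityMeasure v (Iic a) = ENNReal.ofReal (densityCDF v a) := by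
  rw [densityMeasure, withDensity_apply _ measurableSet_Iic,
    ← ofReal_integral_eq_lintegral_ofReal hv.integrable.restrict (ae_restrict_of_ae hv.nonneg),
    densityCDF, intervalIntegral.integral_of_le ha.1, leb,
    Measure.restrict_restrict measurableSet_Iic]
  congr 1
  apply setIntegral_congr_set
  have h1 : ∀ᵐ x : ℝ, x ≠ 1 := by simp [ae_iff]
  filter_upwards [h1] with x hx
  apply propext
  change (x ≤ a ∧ 0 < x ∧ x < 1) ↔ 0 < x ∧ x ≤ a
  constructor
  · exact fun h => ⟨h.2.1, h.1⟩
  · exact fun h => ⟨h.2, h.1, lt_of_le_of_ne (h.2.trans ha.2) hx⟩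

lemma leb_Iic {y : ℝ} (hy : y ∈ Icc (0 : ℝ) 1) : leb (Iic y) = ENNReal.ofReal y := by
  have h : IsProbDensity fun _ => 1 :=
    ⟨integrable_const 1, ae_of_all _ fun _ => zero_le_one, by simp⟩
  simpa [densityMeasure, densityCDF] using h.densityMeasure_Iic hy

/-- The distribution function of an atomless measure pushes it forward to the uniform measure. -/
lemma IsProbDensity.map_densityCDF (hv : IsProbDensity v) (hm : Monotone (densityCDF v))
    (hc : Continuous (densityCDF v)) : (densityMeasure v).map (densityCDF v) = leb := by
  have := hv.isProbabilityMeasure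
  have h0 : densityCDF v 0 = 0 := by simp [densityCDF]
  have h1 : densityCDF v 1 = 1 := by rw [densityCDF, ← integral_leb, hv.integral_eq_one]
  have : IsProbabilityMeasure ((densityMeasure v).map (densityCDF v)) :=
    Measure.isProbabilityMeasure_map hc.measurable.aemeasurable
  refine Measure.ext_of_Iic _ _ fun y => ?_
  rw [Measure.map_apply hc.measurable measurableSet_Iic]
  rcases lt_or_ge y 0 with hy | hy
  · rw [measure_eq_zero_iff_ae_notMem.2, measure_eq_zero_iff_ae_notMem.2]
    · filter_upwards [ae_leb_mem] with x hx h using absurd (hx.1.trans_le h) (not_lt.2 hy.le)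
    · filter_upwards [ae_densityMeasure_mem v] with x hx h
      have := hm hx.1.le
      rw [h0] at this
      exact absurd (this.trans h) (not_le.2 hy)
  rcases lt_or_ge 1 y with hy1 | hy1
  · rw [(mem_ae_iff_prob_eq_one (hc.measurable measurableSet_Iic)).1,
      (mem_ae_iff_prob_eq_one measurableSet_Iic).1]
    · filter_upwards [ae_leb_mem] with x hx using hx.2.le.trans hy1.le
    · filter_upwards [ae_densityMeasure_mem v] with x hx
      have := hm hx.2.le
      rw [h1] at this
      exact this.trans hy1.le
  · have hK : IsCompact (Icc (0 : ℝ) 1 ∩ densityCDF v ⁻¹' Iic y) :=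
      isCompact_Icc.inter_right (isClosed_Iic.preimage hc)
    -- The sublevel set of the distribution function is `[0, a]`, and continuity makes its value at
    -- the greatest point `a` equal to `y`.
    obtain ⟨a, ⟨ha01, hay⟩, hamax⟩ :=
      hK.exists_isGreatest ⟨0, by simp, by simpa [h0] using hy⟩
    have hUa : densityCDF v a = y := by
      obtain ⟨b, hb, hby⟩ := intermediate_value_Icc zero_le_one hc.continuousOn
        (show y ∈ Icc (densityCDF v 0) (densityCDF v 1) by rw [h0, h1]; exact ⟨hy, hy1⟩)
      refine le_antisymm hay ?_
      rw [← hby]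
      exact hm (hamax ⟨hb, hby.le⟩)
    rw [leb_Iic ⟨hy, hy1⟩, ← hUa, ← hv.densityMeasure_Iic ha01]
    apply measure_congr
    filter_upwards [ae_densityMeasure_mem v] with x hx
    apply propext
    change densityCDF v x ≤ densityCDF v a ↔ x ≤ a
    exact ⟨fun h => hamax ⟨Ioo_subset_Icc_self hx, h.trans hay⟩, fun h => hm h⟩

end Density

/-! ### Both distances as the `L²` norm of the centred distribution function -/

section Main

variable {u : ℝ → ℝ}

lemma IsProbDensity.densityCDF_sub (hu : IsProbDensity u) {x : ℝ} (hx : x ∈ Icc (0 : ℝ) 1) :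
    densityCDF u x - x = ∫ s in (0 : ℝ)..x, (u s - 1) := by
  rw [intervalIntegral.integral_sub _ intervalIntegrable_const, densityCDF]
  · simp
  · refine (integrable_leb_iff.1 hu.integrable).mono_set ?_
    rw [uIcc_of_le hx.1, uIcc_of_le zero_le_one]
    exact Icc_subset_Icc_right hx.2

lemma IsProbDensity.integral_sub_one (hu : IsProbDensity u) : ∫ x, (u x - 1) ∂leb = 0 := by
  rw [integral_sub hu.integrable (integrable_const 1), hu.integral_eq_one]
  simp

lemma IsProbDensity.hDotNegOneNorm_eq (hu : IsProbDensity u) :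
    hDotNegOneNorm (fun x => u x - 1) =
      ENNReal.ofReal (√(∫ x in (0 : ℝ)..1, (densityCDF u x - x) ^ 2)) := by
  have ht : Integrable (fun x => u x - 1) leb := hu.integrable.sub (integrable_const 1)
  rw [UnitInterval01.hDotNegOneNorm_eq ht hu.integral_sub_one]
  congr 2
  refine intervalIntegral.integral_congr fun x hx => ?_
  rw [uIcc_of_le zero_le_one] at hx
  simp only [hu.densityCDF_sub hx]

/-- Under the optimal map `U` the transport cost is `∫ (x - U)² u`. Replacing the weight `u` by `1`
changes it by `∫ (U - x)² (u - 1) = 0`, the integral of the derivative of `(U - x)³ / 3`. -/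
lemma IsProbDensity.integral_cost (hu : IsProbDensity u) :
    ∫ x, (x - densityCDF u x) ^ 2 ∂densityMeasure u =
      ∫ x in (0 : ℝ)..1, (densityCDF u x - x) ^ 2 := by
  have hui := integrable_leb_iff.1 hu.integrable
  have hti : IntervalIntegrable (fun x => u x - 1) volume 0 1 := hui.sub intervalIntegrable_const
  have hT := (hti.absolutelyContinuousOnInterval_intervalIntegral (c := 0) (by simp)).continuousOn
  have h0 := integral_primitive_sq_mul_eq_zero hti (by rw [← integral_leb, hu.integral_sub_one])
  have hcongr : ∀ x ∈ Ioo (0 : ℝ) 1, (densityCDF u x - x) ^ 2 =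
      (∫ s in (0 : ℝ)..x, (u s - 1)) ^ 2 := fun x hx => by
    rw [hu.densityCDF_sub (Ioo_subset_Icc_self hx)]
  have e1 : ∫ x, (x - densityCDF u x) ^ 2 ∂densityMeasure u =
      ∫ x in (0 : ℝ)..1, (∫ s in (0 : ℝ)..x, (u s - 1)) ^ 2 * u x := by
    rw [densityMeasure, integral_withDensity_eq_integral_toReal_smul₀
      hu.integrable.aestronglyMeasurable.aemeasurable.ennreal_ofReal
      (ae_of_all _ fun _ => ENNReal.ofReal_lt_top), ← integral_leb]
    apply integral_congr_ae
    filter_upwards [ae_leb_mem, hu.nonneg] with x hx hx0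
    rw [← hcongr x hx, ENNReal.toReal_ofReal hx0, smul_eq_mul]
    ring
  have e2 : ∫ x in (0 : ℝ)..1, (densityCDF u x - x) ^ 2 =
      ∫ x in (0 : ℝ)..1, (∫ s in (0 : ℝ)..x, (u s - 1)) ^ 2 := by
    rw [← integral_leb, ← integral_leb]
    apply integral_congr_ae
    filter_upwards [ae_leb_mem] with x hx using hcongr x hx
  simp only [mul_sub, mul_one] at h0
  have hT2 : ContinuousOn (fun x => (∫ s in (0 : ℝ)..x, (u s - 1)) ^ 2) (uIcc 0 1) := hT.pow 2
  rw [intervalIntegral.integral_sub (hui.continuousOn_mul hT2) hT2.intervalIntegrable] at h0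
  rw [e1, e2]
  linarith

lemma IsProbDensity.wasserstein2_of_nonneg (hu : IsProbDensity u) (hi : Integrable u)
    (hn : ∀ x, 0 ≤ u x) :
    wasserstein2 (densityMeasure u) leb =
      ENNReal.ofReal (√(∫ x in (0 : ℝ)..1, (densityCDF u x - x) ^ 2)) := by
  have hii : ∀ a b : ℝ, IntervalIntegrable u volume a b := fun a b => hi.intervalIntegrable
  have hc : Continuous (densityCDF u) := intervalIntegral.continuous_primitive hii 0
  have hm : Monotone (densityCDF u) := fun x y hxy => by
    rw [← sub_nonneg, densityCDF, densityCDF,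
      intervalIntegral.integral_interval_sub_left (hii _ _) (hii _ _)]
    exact intervalIntegral.integral_nonneg hxy fun t _ => hn t
  have := hu.isProbabilityMeasure
  have key := wasserstein2_map_of_monotone
    ((ae_densityMeasure_mem u).mono fun x hx => Ioo_subset_Icc_self hx) hm
    (by simp [densityCDF]) (by rw [densityCDF, ← integral_leb, hu.integral_eq_one])
  rwa [hu.map_densityCDF hm hc, hu.integral_cost] at key

/-- The density may be changed on a null set and outside the unit interval, so that its distribution
function is monotone and continuous on the whole line. -/
lemma IsProbDensity.wasserstein2_eq (hu : IsProbDensity u) :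
    wasserstein2 (densityMeasure u) leb =
      ENNReal.ofReal (√(∫ x in (0 : ℝ)..1, (densityCDF u x - x) ^ 2)) := by
  let v : ℝ → ℝ := (Ioo (0 : ℝ) 1).indicator fun x => max (u x) 0
  have huv : u =ᵐ[leb] v := by
    filter_upwards [ae_leb_mem, hu.nonneg] with x hx hx0
    simp only [v, indicator_of_mem hx, max_eq_left hx0]
  have hv : IsProbDensity v :=
    { integrable := hu.integrable.congr huv
      nonneg := hu.nonneg.congr (huv.mono fun x hx => by rw [hx])
      integral_eq_one := by rw [← integral_congr_ae huv, hu.integral_eq_one] }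
  have hi : Integrable v := (integrable_indicator_iff measurableSet_Ioo).2 hu.integrable.pos_part
  have hd : densityMeasure u = densityMeasure v :=
    withDensity_congr_ae (huv.mono fun x hx => by simp only [hx])
  rw [hd, hv.wasserstein2_of_nonneg hi fun x => indicator_nonneg (fun _ _ => le_max_right _ _) x]
  congr 2
  refine intervalIntegral.integral_congr fun x hx => ?_
  rw [uIcc_of_le zero_le_one] at hx
  have : densityCDF v x = densityCDF u x := by
    simp only [densityCDF, intervalIntegral.integral_of_le hx.1, integral_Ioc_eq_integral_Ioo]
    refine integral_congr_ae (ae_restrict_of_ae_restrict_of_subset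
      (Ioo_subset_Ioo_right hx.2) huv.symm)
  simp only [this]

end Main

end UnitInterval01

/-- The signed measure `μ_u - λ` has density `u - 1` on `(0,1)`. -/
theorem lemma1 (u : ℝ → ℝ) (hu : UnitInterval01.IsProbDensity u) :
    UnitInterval01.hDotNegOneNorm (fun x => u x - 1) =
        UnitInterval01.wasserstein2 (UnitInterval01.densityMeasure u) UnitInterval01.leb ∧
      UnitInterval01.hDotNegOneNorm (fun x => u x - 1) ^ 2 =
        ENNReal.ofReal (∫ x in (0 : ℝ)..1, (UnitInterval01.densityCDF u x - x) ^ 2) ∧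
      UnitInterval01.wasserstein2 (UnitInterval01.densityMeasure u) UnitInterval01.leb ^ 2 =
        ENNReal.ofReal (∫ x in (0 : ℝ)..1, (UnitInterval01.densityCDF u x - x) ^ 2) := by
  have hsq : ENNReal.ofReal (√(∫ x in (0 : ℝ)..1, (UnitInterval01.densityCDF u x - x) ^ 2)) ^ 2 =
      ENNReal.ofReal (∫ x in (0 : ℝ)..1, (UnitInterval01.densityCDF u x - x) ^ 2) := by
    rw [← ENNReal.ofReal_pow (Real.sqrt_nonneg _), Real.sq_sqrt
      (intervalIntegral.integral_nonneg zero_le_one fun x _ => sq_nonneg _)]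
  rw [hu.hDotNegOneNorm_eq, hu.wasserstein2_eq]
  exact ⟨rfl, hsq, hsq⟩
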